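/- Let $D$ be an oriented link diagram on the sphere $S^2$. Its enhanced checkerboard graph $\Phi(D)$ is the signed directed multigraph whose vertices are all regions of $D$ (of both colours of the checkerboard colouring) and which has, for each crossing, one edge, directed from the region lying between the two incoming strand ends to the opposite region lying between the two outgoing strand ends, and signed by the type of the crossing (its usual sign $\pm1$ as an oriented crossing). The diagram $D$ is called alternative if no walk in $\Phi(D)$ (edges may be traversed in either direction) contains both a positive and a negative edge. Draw a crossing $c$ in a disc with four marked boundary points NE, NW, SW, SE, in any of the four possible positions. Its unoriented sign in this position is $+1$ if the overstrand joins SW and NE, and $-1$ if it joins NW and SE. A rational tangle diagram with continued fraction $[a_1,\dots,a_n]$, $a_i\in\mathbb Z\setminus\{0\}$, is built from a row of $|a_1|$ horizontal twists by adding, for $i=2,\dots,n$, $|a_i|$ twists, vertical ones (above and/or below) if $i$ is even and horizontal ones (left and/or right) if $i$ is odd; the crossings of the $i$-th box have the unoriented sign of $a_i$ in the disc. A block of rational tangles is a tangle obtained from finitely many rational tangles by iterated sums (side by side) and products (one on top of the other). An oriented block of rational tangles extends the oriented crossing $c$ if all denominators $a_i$ of all its rational tangles have the sign of the unoriented crossing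 $c$ in the chosen position, and all its crossings, as oriented crossings, have the same type as $c$. Theorem. Let $D$ be an alternative diagram and let $c$ be any crossing of $D$, in any such position. Let $D^*$ be obtained from $D$ by replacing $c$ by a block of oriented rational tangles that extends $c$ and whose orientation agrees with that of $D$ at the four marked points. Then $D^*$ is again an oriented link diagram on $S^2$, and it is alternative. -/

import Mathlib

/-!
Oriented link diagrams on the sphere, rational tangles and blocks of them, replacement of a
crossing by an oriented tangle, and the enhanced checkerboard graph.

Conventions. The four ends ("darts") of a crossing are numbered counterclockwise by `Fin 4`.
When a crossing, or a tangle, is drawn in a disc with marked boundary points, the numbers are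
`0 = NE`, `1 = NW`, `2 = SW`, `3 = SE`. The corner (local region) between the ends `k` and `k + 1`
is also numbered `k`, so that the corners are `0 = N`, `1 = W`, `2 = S`, `3 = E`.
The sign of an unoriented crossing in such a picture is `+1` if the overstrand joins the
ends `0` and `2`, and `-1` if it joins the ends `1` and `3`; a quarter turn changes it.
-/

namespace Twisting

/-! ### Oriented crossings -/

/-- For an oriented crossing (`out k` says that the end `k` is directed away from the crossing;
opposite ends have opposite directions), the corner between the two outgoing ends. -/
def outCorner (out : Fin 4 → Bool) : Fin 4 :=
  if out 0 then (if out 1 then 0 else 3) else (if out 1 then 1 else 2)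

/-- The type (the usual sign, or writhe) of an oriented crossing, from its unoriented sign in some
numbering of the ends and the directions of the ends: it is `+1` if, looking along the orientation,
the overstrand passes from the lower left to the upper right. It does not depend on the choice
of the numbering. -/
def crossingType (s : ℤˣ) (out : Fin 4 → Bool) : ℤˣ :=
  s * (-1) ^ (outCorner out).val

/-! ### Tangles -/

/-- Tangle diagrams made of single crossings by sums (juxtaposition, left to right) and products
(stacking, top to bottom). -/
inductive Tangle : Type where
  /-- a single crossing with the given (unoriented) sign -/
  | crossing (s : ℤˣ) : Tangle
  /-- `sum A B`: the tangle `A` to the left of the tangle `B` -/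
  | sum (A B : Tangle) : Tangle
  /-- `prod A B`: the tangle `A` on top of the tangle `B` -/
  | prod (A B : Tangle) : Tangle

namespace Tangle

/-- The crossings of a tangle. -/
def Crossing : Tangle → Type
  | crossing _ => Unit
  | sum A B => A.Crossing ⊕ B.Crossing
  | prod A B => A.Crossing ⊕ B.Crossing

instance instFiniteCrossing : (T : Tangle) → Finite T.Crossing
  | crossing _ => inferInstanceAs (Finite Unit)
  | sum A B =>
    haveI := instFiniteCrossing A
    haveI := instFiniteCrossing B
    inferInstanceAs (Finite (A.Crossing ⊕ B.Crossing))
  | prod A B =>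
    haveI := instFiniteCrossing A
    haveI := instFiniteCrossing B
    inferInstanceAs (Finite (A.Crossing ⊕ B.Crossing))

/-- The ends of the crossings of a tangle. -/
abbrev Dart (T : Tangle) : Type := T.Crossing × Fin 4

/-- The unoriented sign of a crossing of a tangle, in the position in which the tangle is drawn. -/
def slope : (T : Tangle) → T.Crossing → ℤˣ
  | crossing s => fun _ => s
  | sum A B => Sum.elim A.slope B.slope
  | prod A B => Sum.elim A.slope B.slope

/-- The crossing at which the strand starting at the marked boundary point `k` arrives first;
it arrives there at the end `k`. -/
def endCrossing : (T : Tangle) → Fin 4 → T.Crossing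
  | crossing _ => fun _ => ()
  | sum A B => fun k => match k with
    | 0 => Sum.inr (B.endCrossing 0)
    | 1 => Sum.inl (A.endCrossing 1)
    | 2 => Sum.inl (A.endCrossing 2)
    | 3 => Sum.inr (B.endCrossing 3)
  | prod A B => fun k => match k with
    | 0 => Sum.inl (A.endCrossing 0)
    | 1 => Sum.inl (A.endCrossing 1)
    | 2 => Sum.inr (B.endCrossing 2)
    | 3 => Sum.inr (B.endCrossing 3)

/-- The dart that is joined to the marked boundary point `k`. -/
def endDart (T : Tangle) (k : Fin 4) : T.Dart := (T.endCrossing k, k)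

/-- The other side of an arc of the tangle diagram: the arc starting at the given dart leads
either to another dart or to a marked boundary point. In a sum, the points `NE`, `SE` of the left
tangle are identified with the points `NW`, `SW` of the right one; in a product, the
points `SW`, `SE` of the upper tangle are identified with the points `NW`, `NE` of the lower one. -/
def partner : (T : Tangle) → T.Dart → T.Dart ⊕ Fin 4
  | crossing _ => fun d => Sum.inr d.2
  | sum A B => fun d => match d with
    | (Sum.inl x, k) => match A.partner (x, k) with
      | Sum.inl e => Sum.inl (Sum.inl e.1, e.2)
      | Sum.inr 0 => Sum.inl (Sum.inr (B.endCrossing 1), 1)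
      | Sum.inr 1 => Sum.inr 1
      | Sum.inr 2 => Sum.inr 2
      | Sum.inr 3 => Sum.inl (Sum.inr (B.endCrossing 2), 2)
    | (Sum.inr x, k) => match B.partner (x, k) with
      | Sum.inl e => Sum.inl (Sum.inr e.1, e.2)
      | Sum.inr 0 => Sum.inr 0
      | Sum.inr 1 => Sum.inl (Sum.inl (A.endCrossing 0), 0)
      | Sum.inr 2 => Sum.inl (Sum.inl (A.endCrossing 3), 3)
      | Sum.inr 3 => Sum.inr 3
  | prod A B => fun d => match d with
    | (Sum.inl x, k) => match A.partner (x, k) with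
      | Sum.inl e => Sum.inl (Sum.inl e.1, e.2)
      | Sum.inr 0 => Sum.inr 0
      | Sum.inr 1 => Sum.inr 1
      | Sum.inr 2 => Sum.inl (Sum.inr (B.endCrossing 1), 1)
      | Sum.inr 3 => Sum.inl (Sum.inr (B.endCrossing 0), 0)
    | (Sum.inr x, k) => match B.partner (x, k) with
      | Sum.inl e => Sum.inl (Sum.inr e.1, e.2)
      | Sum.inr 0 => Sum.inl (Sum.inl (A.endCrossing 3), 3)
      | Sum.inr 1 => Sum.inl (Sum.inl (A.endCrossing 2), 2)
      | Sum.inr 2 => Sum.inr 2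
      | Sum.inr 3 => Sum.inr 3

theorem fin_four (k : Fin 4) : k = 0 ∨ k = 1 ∨ k = 2 ∨ k = 3 := by
  omega

theorem partner_endDart (T : Tangle) (k : Fin 4) : T.partner (T.endDart k) = Sum.inr k := by
  induction T generalizing k with
  | crossing s => rfl
  | sum A B hA hB =>
    simp only [endDart] at hA hB
    rcases fin_four k with rfl | rfl | rfl | rfl <;> simp [endDart, endCrossing, partner, hA, hB]
  | prod A B hA hB =>
    simp only [endDart] at hA hB
    rcases fin_four k with rfl | rfl | rfl | rfl <;> simp [endDart, endCrossing, partner, hA, hB]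

theorem eq_endDart_of_partner (T : Tangle) (d : T.Dart) (k : Fin 4)
    (h : T.partner d = Sum.inr k) : d = T.endDart k := by
  induction T generalizing k with
  | crossing s =>
    obtain ⟨⟨⟩, j⟩ := d
    simp only [partner, Sum.inr.injEq] at h
    subst h
    rfl
  | sum A B hA hB =>
    obtain ⟨x | x, j⟩ := d
    · rcases hp : A.partner (x, j) with e | i
      · simp [partner, hp] at h
      · have hx := hA (x, j) i hp
        simp only [endDart, Prod.mk.injEq] at hx
        obtain ⟨rfl, rfl⟩ := hx
        rcases fin_four j with rfl | rfl | rfl | rfl <;> simp [partner, hp] at h <;> subst h <;> rfl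
    · rcases hp : B.partner (x, j) with e | i
      · simp [partner, hp] at h
      · have hx := hB (x, j) i hp
        simp only [endDart, Prod.mk.injEq] at hx
        obtain ⟨rfl, rfl⟩ := hx
        rcases fin_four j with rfl | rfl | rfl | rfl <;> simp [partner, hp] at h <;> subst h <;> rfl
  | prod A B hA hB =>
    obtain ⟨x | x, j⟩ := d
    · rcases hp : A.partner (x, j) with e | i
      · simp [partner, hp] at h
      · have hx := hA (x, j) i hp
        simp only [endDart, Prod.mk.injEq] at hx
        obtain ⟨rfl, rfl⟩ := hx
        rcases fin_four j with rfl | rfl | rfl | rfl <;> simp [partner, hp] at h <;> subst h <;> rfl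
    · rcases hp : B.partner (x, j) with e | i
      · simp [partner, hp] at h
      · have hx := hB (x, j) i hp
        simp only [endDart, Prod.mk.injEq] at hx
        obtain ⟨rfl, rfl⟩ := hx
        rcases fin_four j with rfl | rfl | rfl | rfl <;> simp [partner, hp] at h <;> subst h <;> rfl

theorem partner_symm (T : Tangle) (d e : T.Dart)
    (h : T.partner d = Sum.inl e) : T.partner e = Sum.inl d := by
  induction T with
  | crossing s => simp [partner] at h
  | sum A B hA hB =>
    have eA := A.partner_endDart
    have eB := B.partner_endDart
    simp only [endDart] at eA eB
    obtain ⟨x | x, j⟩ := d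
    · rcases hp : A.partner (x, j) with f | i
      · have hs := hA (x, j) f hp
        simp only [partner, hp, Sum.inl.injEq] at h
        subst h
        simp [partner, hs]
      · have hx := A.eq_endDart_of_partner (x, j) i hp
        simp only [endDart, Prod.mk.injEq] at hx
        obtain ⟨rfl, rfl⟩ := hx
        rcases fin_four j with rfl | rfl | rfl | rfl <;> simp [partner, hp] at h <;>
          subst h <;> simp [partner, eB]
    · rcases hp : B.partner (x, j) with f | i
      · have hs := hB (x, j) f hp
        simp only [partner, hp, Sum.inl.injEq] at h
        subst h
        simp [partner, hs]
      · have hx := B.eq_endDart_of_partner (x, j) i hp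
        simp only [endDart, Prod.mk.injEq] at hx
        obtain ⟨rfl, rfl⟩ := hx
        rcases fin_four j with rfl | rfl | rfl | rfl <;> simp [partner, hp] at h <;>
          subst h <;> simp [partner, eA]
  | prod A B hA hB =>
    have eA := A.partner_endDart
    have eB := B.partner_endDart
    simp only [endDart] at eA eB
    obtain ⟨x | x, j⟩ := d
    · rcases hp : A.partner (x, j) with f | i
      · have hs := hA (x, j) f hp
        simp only [partner, hp, Sum.inl.injEq] at h
        subst h
        simp [partner, hs]
      · have hx := A.eq_endDart_of_partner (x, j) i hp
        simp only [endDart, Prod.mk.injEq] at hx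
        obtain ⟨rfl, rfl⟩ := hx
        rcases fin_four j with rfl | rfl | rfl | rfl <;> simp [partner, hp] at h <;>
          subst h <;> simp [partner, eB]
    · rcases hp : B.partner (x, j) with f | i
      · have hs := hB (x, j) f hp
        simp only [partner, hp, Sum.inl.injEq] at h
        subst h
        simp [partner, hs]
      · have hx := B.eq_endDart_of_partner (x, j) i hp
        simp only [endDart, Prod.mk.injEq] at hx
        obtain ⟨rfl, rfl⟩ := hx
        rcases fin_four j with rfl | rfl | rfl | rfl <;> simp [partner, hp] at h <;>
          subst h <;> simp [partner, eA]

/-- An orientation of the strands of a tangle diagram: `out d` says that the dart `d` is directed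
away from its crossing. -/
structure Orientation (T : Tangle) where
  out : T.Dart → Bool
  out_opposite : ∀ x k, out (x, k + 2) = !out (x, k)
  out_partner : ∀ d e, T.partner d = Sum.inl e → out e = !out d

/-- The type of a crossing of an oriented tangle. -/
def Orientation.type {T : Tangle} (o : T.Orientation) (x : T.Crossing) : ℤˣ :=
  crossingType (T.slope x) fun k => o.out (x, k)

end Tangle

/-! ### Rational tangles and blocks -/

/-- The sign of a nonzero integer, as a unit. -/
def unitSign (a : ℤ) : ℤˣ := if 0 < a then 1 else -1

/-- A box of twists: a nonzero integer `a`, that is `|a|` crossings with the sign of `a`, of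
which `before` are placed on the left of (resp. above) the tangle already built, and the
others on the right of (resp. below) it. -/
structure Box where
  a : ℤ
  a_ne_zero : a ≠ 0
  before : ℕ
  before_le : before ≤ a.natAbs

/-- Add a row of horizontal twists to a tangle. -/
def Box.addHorizontal (b : Box) (T : Tangle) : Tangle :=
  (fun S => Tangle.sum (.crossing (unitSign b.a)) S)^[b.before]
    ((fun S => Tangle.sum S (.crossing (unitSign b.a)))^[b.a.natAbs - b.before] T)

/-- Add a column of vertical twists to a tangle. -/
def Box.addVertical (b : Box) (T : Tangle) : Tangle :=
  (fun S => Tangle.prod (.crossing (unitSign b.a)) S)^[b.before]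
    ((fun S => Tangle.prod S (.crossing (unitSign b.a)))^[b.a.natAbs - b.before] T)

/-- Add boxes of twists, alternately vertical and horizontal, to a tangle; `vertical` says
whether the first of them is vertical. -/
def addBoxes : (vertical : Bool) → List Box → Tangle → Tangle
  | _, [], T => T
  | true, b :: l, T => addBoxes false l (b.addVertical T)
  | false, b :: l, T => addBoxes true l (b.addHorizontal T)

/-- The diagram of a rational tangle given by a continued fraction `[a₁, a₂, …, aₙ]` with
nonzero denominators, in twist form: start with a row of `|a₁|` horizontal twists and add, for
`i = 2, …, n`, a box of `|aᵢ|` twists, vertical for even `i` and horizontal for odd `i`. -/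
structure RationalTangle where
  a₁ : ℤ
  a₁_ne_zero : a₁ ≠ 0
  boxes : List Box

namespace RationalTangle

/-- The denominators `a₁, a₂, …, aₙ` of the continued fraction. -/
def denominators (R : RationalTangle) : List ℤ := R.a₁ :: R.boxes.map Box.a

/-- The tangle diagram of a rational tangle. -/
def toTangle (R : RationalTangle) : Tangle :=
  addBoxes true R.boxes
    ((fun S => Tangle.sum S (.crossing (unitSign R.a₁)))^[R.a₁.natAbs - 1]
      (.crossing (unitSign R.a₁)))

/-- The rational tangle extends a crossing of (unoriented) sign `ε`: all denominators have the
sign `ε`. -/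
def Extends (R : RationalTangle) (ε : ℤˣ) : Prop :=
  ∀ a ∈ R.denominators, unitSign a = ε

end RationalTangle

/-- A block of rational tangles: a finite iterated sum and product of rational tangles. -/
inductive Block : Type where
  | rational (R : RationalTangle) : Block
  | sum (A B : Block) : Block
  | prod (A B : Block) : Block

namespace Block

/-- The tangle diagram of a block. -/
def toTangle : Block → Tangle
  | rational R => R.toTangle
  | sum A B => .sum A.toTangle B.toTangle
  | prod A B => .prod A.toTangle B.toTangle

/-- The block extends a crossing of (unoriented) sign `ε`: each rational tangle in it does. -/
def Extends (ε : ℤˣ) : Block → Prop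
  | rational R => R.Extends ε
  | sum A B => A.Extends ε ∧ B.Extends ε
  | prod A B => A.Extends ε ∧ B.Extends ε

end Block

/-! ### Oriented link diagrams -/

/-- A combinatorial oriented diagram: finitely many crossings with four ends each, the ends being
joined in pairs by arcs, and finitely many components without crossings (`Loop`).
The condition that it is a diagram on the sphere is `OrientedDiagram.IsSpherical` below.
For a disconnected diagram the data must also tell how the connected pieces lie in each other's
regions: `glue` lists pairs of corners, or sides of loops, that lie in a common region. -/
structure OrientedDiagram where
  Crossing : Type
  Loop : Type
  finite_crossing : Finite Crossing
  finite_loop : Finite Loop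
  /-- the other end of the arc that starts at a dart -/
  join : Crossing × Fin 4 → Crossing × Fin 4
  join_join : ∀ d, join (join d) = d
  /-- the unoriented sign of a crossing with respect to the numbering of its ends -/
  slope : Crossing → ℤˣ
  /-- the dart is directed away from its crossing -/
  out : Crossing × Fin 4 → Bool
  out_opposite : ∀ x k, out (x, k + 2) = !out (x, k)
  out_join : ∀ d, out (join d) = !out d
  /-- pairs of corners or sides of loops (`(l, true)` is the left side and `(l, false)` the right
  side of `l`) that are declared to lie in the same region -/
  glue : (Crossing × Fin 4) ⊕ (Loop × Bool) → (Crossing × Fin 4) ⊕ (Loop × Bool) → Prop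

namespace OrientedDiagram

/-- The ends of the crossings; also the corners, the corner `(x, k)` lying between the ends
`(x, k)` and `(x, k + 1)`. -/
abbrev Dart (D : OrientedDiagram) : Type := D.Crossing × Fin 4

/-- The local pieces of regions: corners at crossings and sides of loops. -/
abbrev Side (D : OrientedDiagram) : Type := D.Dart ⊕ (D.Loop × Bool)

/-- Two local pieces of regions are neighbours: they lie along the same side of an arc (the corner
to the left of a dart, followed to the other end of the arc), or are declared to lie in the same
region. -/
inductive RegionStep (D : OrientedDiagram) : D.Side → D.Side → Prop where
  | arc (d : D.Dart) :
      RegionStep D (Sum.inl d) (Sum.inl ((D.join d).1, (D.join d).2 - 1))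
  | glue (s t : D.Side) (h : D.glue s t) : RegionStep D s t

/-- The regions of a diagram. -/
def Region (D : OrientedDiagram) : Type := Quot D.RegionStep

/-- The region that contains a corner. -/
def regionOf (D : OrientedDiagram) (d : D.Dart) : D.Region := Quot.mk _ (Sum.inl d)

/-- Two darts at the same crossing or on the same arc, or the two sides of a loop, belong to the
same connected piece of the diagram. -/
inductive PieceStep (D : OrientedDiagram) : D.Side → D.Side → Prop where
  | crossing (x : D.Crossing) (k l : Fin 4) : PieceStep D (Sum.inl (x, k)) (Sum.inl (x, l))
  | arc (d : D.Dart) : PieceStep D (Sum.inl d) (Sum.inl (D.join d))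
  | loop (l : D.Loop) (a b : Bool) : PieceStep D (Sum.inr (l, a)) (Sum.inr (l, b))

/-- The connected pieces of the underlying plane curve (not the components of the link). -/
def Piece (D : OrientedDiagram) : Type := Quot D.PieceStep

/-- The diagram lies on the sphere: the surface formed by the regions along the diagram is
connected and Euler's formula `V - E + R = 1 + (number of connected pieces)` holds. Here `E = 2 V`
for the pieces with crossings, and loops contribute nothing to `V - E`. -/
structure IsSpherical (D : OrientedDiagram) : Prop where
  connected : ∀ s t : D.Side,
    Relation.EqvGen (fun a b => D.RegionStep a b ∨ D.PieceStep a b) s t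
  euler : Nat.card D.Region = Nat.card D.Crossing + Nat.card D.Piece + 1

/-- The type (sign as an oriented crossing) of a crossing. -/
def type (D : OrientedDiagram) (x : D.Crossing) : ℤˣ :=
  crossingType (D.slope x) fun k => D.out (x, k)

/-- The unoriented sign of the crossing `x` when it is drawn so that its end number `k` points to
the marked point `k + r` of the disc (`0 = NE`, `1 = NW`, `2 = SW`, `3 = SE`). -/
def signInDisc (D : OrientedDiagram) (x : D.Crossing) (r : Fin 4) : ℤˣ :=
  D.slope x * (-1) ^ r.val

end OrientedDiagram

/-! ### Replacing a crossing by an oriented tangle -/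

/-- The oriented tangle fits into the diagram in place of the crossing `c`, drawn in a disc as
prescribed by `r`: the directions of the strands agree on the boundary of the disc. -/
def Tangle.Orientation.Fits {T : Tangle} (o : T.Orientation) (D : OrientedDiagram)
    (c : D.Crossing) (r : Fin 4) : Prop :=
  ∀ k, o.out (T.endDart (k + r)) = D.out (c, k)

namespace OrientedDiagram

/-- Darts (and corners) of `D` in the diagram in which the crossing `c` is replaced by the
tangle `T`: those at `c` become the darts (corners) of `T` at the boundary of the disc. -/
noncomputable def liftDart (D : OrientedDiagram) (c : D.Crossing) (r : Fin 4) (T : Tangle)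
    (d : D.Dart) : ({x : D.Crossing // x ≠ c} ⊕ T.Crossing) × Fin 4 :=
  open Classical in
  if h : d.1 = c then (Sum.inr (T.endDart (d.2 + r)).1, (T.endDart (d.2 + r)).2)
  else (Sum.inl ⟨d.1, h⟩, d.2)

/-- The other end of an arc after the replacement. -/
noncomputable def replaceJoin (D : OrientedDiagram) (c : D.Crossing) (r : Fin 4) (T : Tangle) :
    ({x : D.Crossing // x ≠ c} ⊕ T.Crossing) × Fin 4 →
      ({x : D.Crossing // x ≠ c} ⊕ T.Crossing) × Fin 4
  | (Sum.inl x, k) => D.liftDart c r T (D.join (x.1, k))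
  | (Sum.inr y, k) => match T.partner (y, k) with
    | Sum.inl e => (Sum.inr e.1, e.2)
    | Sum.inr j => D.liftDart c r T (D.join (c, j - r))

theorem replaceJoin_liftDart (D : OrientedDiagram) (c : D.Crossing) (r : Fin 4) (T : Tangle)
    (d : D.Dart) :
    D.replaceJoin c r T (D.liftDart c r T d) = D.liftDart c r T (D.join d) := by
  obtain ⟨x, k⟩ := d
  by_cases h : x = c
  · subst h
    have h1 := T.partner_endDart (k + r)
    have h2 : D.liftDart x r T (x, k) =
        (Sum.inr (T.endDart (k + r)).1, (T.endDart (k + r)).2) := by simp [liftDart]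
    rw [h2]
    simp only [replaceJoin, h1, add_sub_cancel_right]
  · simp [liftDart, replaceJoin, h]

theorem replaceJoin_replaceJoin (D : OrientedDiagram) (c : D.Crossing) (r : Fin 4) (T : Tangle)
    (d : ({x : D.Crossing // x ≠ c} ⊕ T.Crossing) × Fin 4) :
    D.replaceJoin c r T (D.replaceJoin c r T d) = d := by
  obtain ⟨x | y, k⟩ := d
  · have h1 : D.replaceJoin c r T (Sum.inl x, k) = D.liftDart c r T (D.join (x.1, k)) := rfl
    rw [h1, replaceJoin_liftDart, D.join_join]
    simp [liftDart, x.2]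
  · rcases hp : T.partner (y, k) with e | j
    · have hs := T.partner_symm _ _ hp
      simp [replaceJoin, hp, hs]
    · have hy := T.eq_endDart_of_partner _ _ hp
      have h1 : D.replaceJoin c r T (Sum.inr y, k) = D.liftDart c r T (D.join (c, j - r)) := by
        simp only [replaceJoin, hp]
      rw [h1, replaceJoin_liftDart, D.join_join]
      simp [liftDart, ← hy]

/-- The directions of the darts after the replacement. -/
def replaceOut (D : OrientedDiagram) (c : D.Crossing) {T : Tangle} (o : T.Orientation) :
    ({x : D.Crossing // x ≠ c} ⊕ T.Crossing) × Fin 4 → Bool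
  | (Sum.inl x, k) => D.out (x.1, k)
  | (Sum.inr y, k) => o.out (y, k)

theorem replaceOut_liftDart (D : OrientedDiagram) (c : D.Crossing) (r : Fin 4) {T : Tangle}
    (o : T.Orientation) (h : o.Fits D c r) (d : D.Dart) :
    D.replaceOut c o (D.liftDart c r T d) = D.out d := by
  obtain ⟨x, k⟩ := d
  by_cases hx : x = c
  · subst hx
    simpa [liftDart, replaceOut] using h k
  · simp [liftDart, replaceOut, hx]

theorem replaceOut_replaceJoin (D : OrientedDiagram) (c : D.Crossing) (r : Fin 4) {T : Tangle}
    (o : T.Orientation) (h : o.Fits D c r)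
    (d : ({x : D.Crossing // x ≠ c} ⊕ T.Crossing) × Fin 4) :
    D.replaceOut c o (D.replaceJoin c r T d) = !D.replaceOut c o d := by
  obtain ⟨x | y, k⟩ := d
  · simp only [replaceJoin, D.replaceOut_liftDart c r o h, D.out_join]
    rfl
  · rcases hp : T.partner (y, k) with e | j
    · simpa [replaceJoin, hp, replaceOut] using o.out_partner _ _ hp
    · have hy := T.eq_endDart_of_partner _ _ hp
      simp only [replaceJoin, hp, D.replaceOut_liftDart c r o h, D.out_join]
      have hf := h (j - r)
      rw [sub_add_cancel, ← hy] at hf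
      simp [replaceOut, hf]

/-- The diagram obtained from `D` by replacing the crossing `c`, drawn in a disc as prescribed by
`r`, by the oriented tangle `T`. -/
noncomputable def replace (D : OrientedDiagram) (c : D.Crossing) (r : Fin 4) {T : Tangle}
    (o : T.Orientation) (h : o.Fits D c r) : OrientedDiagram where
  Crossing := {x : D.Crossing // x ≠ c} ⊕ T.Crossing
  Loop := D.Loop
  finite_crossing := haveI := D.finite_crossing; inferInstance
  finite_loop := D.finite_loop
  join := D.replaceJoin c r T
  join_join := D.replaceJoin_replaceJoin c r T
  slope := Sum.elim (fun x => D.slope x.1) T.slope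
  out := D.replaceOut c o
  out_opposite := by
    rintro (x | y) k
    · exact D.out_opposite x.1 k
    · exact o.out_opposite y k
  out_join := D.replaceOut_replaceJoin c r o h
  glue := Relation.Map D.glue (Sum.map (D.liftDart c r T) id) (Sum.map (D.liftDart c r T) id)

end OrientedDiagram

/-- The block, with the orientation `o`, extends the oriented crossing `c` of `D`, drawn in a disc
as prescribed by `r`: the denominators of all its rational tangles have the sign of `c`, and
all its crossings, as oriented crossings, are of the type of `c`. -/
structure Block.ExtendsOriented (B : Block) (o : B.toTangle.Orientation) (D : OrientedDiagram)
    (c : D.Crossing) (r : Fin 4) : Prop where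
  sign : B.Extends (D.signInDisc c r)
  type : ∀ x : B.toTangle.Crossing, o.type x = D.type c

/-! ### The enhanced checkerboard graph -/

/-- A directed multigraph with signed edges. -/
structure SignedDigraph where
  Vertex : Type
  Edge : Type
  source : Edge → Vertex
  target : Edge → Vertex
  sign : Edge → ℤˣ

namespace SignedDigraph

/-- Walks; an edge may be traversed in either direction. -/
inductive Walk (G : SignedDigraph) : G.Vertex → G.Vertex → Type where
  | nil (v : G.Vertex) : Walk G v v
  | forward (e : G.Edge) {v : G.Vertex} (w : Walk G (G.target e) v) : Walk G (G.source e) v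
  | backward (e : G.Edge) {v : G.Vertex} (w : Walk G (G.source e) v) : Walk G (G.target e) v

/-- The edges of a walk. -/
def Walk.edges {G : SignedDigraph} {u v : G.Vertex} : G.Walk u v → List G.Edge
  | .nil _ => []
  | .forward e w => e :: w.edges
  | .backward e w => e :: w.edges

/-- No walk contains both a positive and a negative edge. -/
def IsAlternative (G : SignedDigraph) : Prop :=
  ¬ ∃ (u v : G.Vertex) (w : G.Walk u v),
    (∃ e ∈ w.edges, G.sign e = 1) ∧ ∃ e ∈ w.edges, G.sign e = -1

end SignedDigraph

namespace OrientedDiagram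

/-- The enhanced checkerboard graph: its vertices are all the regions (of both colours). Every
crossing gives an edge, with the type of the crossing as its sign, that runs along the orientation
from the region between the two incoming ends to the region between the two outgoing ends; these
are opposite, hence of the same colour. -/
def enhancedCheckerboardGraph (D : OrientedDiagram) : SignedDigraph where
  Vertex := D.Region
  Edge := D.Crossing
  source x := D.regionOf (x, outCorner (fun k => D.out (x, k)) + 2)
  target x := D.regionOf (x, outCorner fun k => D.out (x, k))
  sign := D.type

/-- A diagram is alternative if its enhanced checkerboard graph is. -/
def IsAlternative (D : OrientedDiagram) : Prop :=
  D.enhancedCheckerboardGraph.IsAlternative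

end OrientedDiagram

end Twisting

/-! A signed graph is alternative exactly when its vertices can be labelled by signs so that every
edge has the sign of both of its ends (`isAlternative_iff_exists_labelling`). It is therefore enough
to extend such a labelling from `D` to the new diagram.

The new regions are the regions of `D` together with the regions inside the disc that do not meet
its boundary (`replaceRegionEquiv`). Old regions keep their label and inner regions get the type of
`c`. Crossings outside the disc cause no difficulty. A crossing `y` of the tangle has the unoriented
sign and the type of `c`; since the type is the unoriented sign times a sign given by the parity of
the out-corner, the edges of `y` and of `c` join corners of the same checkerboard colour of the
disc. A corner of that colour lies in an inner region or, by `even_iff_of_region_eq_inl`, in a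
boundary region of that colour, which is the source or the target region of `c`. In each case the
label is the type of `c`. The block structure enters only through the uniform unoriented sign of its
crossings (`Block.Extends.hasSlope`).

For sphericity, every sum and every product creates one inner region, so a tangle with `n` crossings
has `n - 1` of them. The replacement adds `n - 1` crossings and `n - 1` regions and, the tangle
being connected, keeps the number of pieces (`replacePieceEquiv`); Euler's formula survives. -/

namespace Twisting

/-! ### Alternative graphs and sign labellings -/

namespace SignedDigraph

/-- Each edge forces equal labels at its two ends, so the label cannot change along a walk. -/
theorem Walk.sign_eq {G : SignedDigraph} (f : G.Vertex → ℤˣ)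
    (hs : ∀ e, f (G.source e) = G.sign e) (ht : ∀ e, f (G.target e) = G.sign e)
    {u v : G.Vertex} (w : G.Walk u v) : ∀ e ∈ w.edges, G.sign e = f u := by
  induction w with
  | nil v => simp [Walk.edges]
  | forward e w ih =>
    intro e' he'
    rcases List.mem_cons.1 he' with rfl | h
    · exact (hs _).symm
    · rw [ih e' h, ht, hs]
  | backward e w ih =>
    intro e' he'
    rcases List.mem_cons.1 he' with rfl | h
    · exact (ht _).symm
    · rw [ih e' h, ht, hs]

/-- A signed digraph is alternative if and only if its vertices can be labelled by signs in such
a way that every edge has the sign of both of its ends. -/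
theorem isAlternative_iff_exists_labelling {G : SignedDigraph} :
    G.IsAlternative ↔ ∃ f : G.Vertex → ℤˣ,
      (∀ e, f (G.source e) = G.sign e) ∧ ∀ e, f (G.target e) = G.sign e := by
  classical
  constructor
  · intro h
    -- The label is `1` exactly at the vertices from which some walk meets a positive edge; vertices
    -- without edges get `-1`.
    let P : G.Vertex → Prop := fun u => ∃ (v : G.Vertex) (w : G.Walk u v), ∃ e ∈ w.edges, G.sign e = 1
    refine ⟨fun u => if P u then 1 else -1, fun e => ?_, fun e => ?_⟩
    · rcases Int.units_eq_one_or (G.sign e) with he | he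
      · simp only [he]
        rw [if_pos]
        exact ⟨_, .forward e (.nil _), e, by simp [Walk.edges], he⟩
      · simp only [he]
        rw [if_neg]
        -- A positive edge within reach of an end of the negative edge `e` gives a mixed walk once
        -- `e` is put in front.
        rintro ⟨v, w, e', hw, he'⟩
        exact h ⟨_, _, .backward e w, ⟨e', by simp [Walk.edges, hw], he'⟩, e, by simp [Walk.edges], he⟩
    · rcases Int.units_eq_one_or (G.sign e) with he | he
      · simp only [he]
        rw [if_pos]
        exact ⟨_, .backward e (.nil _), e, by simp [Walk.edges], he⟩
      · simp only [he]
        rw [if_neg]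
        rintro ⟨v, w, e', hw, he'⟩
        exact h ⟨_, _, .forward e w, ⟨e', by simp [Walk.edges, hw], he'⟩, e, by simp [Walk.edges], he⟩
  · rintro ⟨f, hs, ht⟩ ⟨u, v, w, ⟨e, he, h1⟩, e', he', h2⟩
    have h3 := (w.sign_eq f hs ht e he).trans (w.sign_eq f hs ht e' he').symm
    rw [h1, h2] at h3
    exact absurd h3 (by decide)

end SignedDigraph

/-! ### Regions of a tangle diagram in the disc -/

namespace Tangle

/-- The regions of a tangle diagram that do not meet the boundary of the disc: every sum and every
product creates one. -/
def Inner : Tangle → Type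
  | crossing _ => Empty
  | sum A B => Option (A.Inner ⊕ B.Inner)
  | prod A B => Option (A.Inner ⊕ B.Inner)

instance instFiniteInner : (T : Tangle) → Finite T.Inner
  | crossing _ => inferInstanceAs (Finite Empty)
  | sum A B =>
    haveI := instFiniteInner A
    haveI := instFiniteInner B
    inferInstanceAs (Finite (Option (A.Inner ⊕ B.Inner)))
  | prod A B =>
    haveI := instFiniteInner A
    haveI := instFiniteInner B
    inferInstanceAs (Finite (Option (A.Inner ⊕ B.Inner)))

/-- In a sum or product the two surplus crossings of the parts are balanced by one new inner region,
leaving a surplus of one. This is the count behind Euler's formula. -/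
theorem card_crossing (T : Tangle) : Nat.card T.Crossing = Nat.card T.Inner + 1 := by
  induction T with
  | crossing s =>
    change Nat.card Unit = Nat.card Empty + 1
    simp
  | sum A B hA hB =>
    change Nat.card (A.Crossing ⊕ B.Crossing) = Nat.card (Option (A.Inner ⊕ B.Inner)) + 1
    rw [Nat.card_sum, Finite.card_option, Nat.card_sum, hA, hB]
    omega
  | prod A B hA hB =>
    change Nat.card (A.Crossing ⊕ B.Crossing) = Nat.card (Option (A.Inner ⊕ B.Inner)) + 1
    rw [Nat.card_sum, Finite.card_option, Nat.card_sum, hA, hB]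
    omega

/-- The region of the tangle diagram that contains a corner: either the region that meets the
boundary of the disc between the marked points `k` and `k + 1`, or an inner region. -/
def region : (T : Tangle) → T.Dart → Fin 4 ⊕ T.Inner
  | crossing _ => fun d => Sum.inl d.2
  | sum A B => fun d => match d with
    | (Sum.inl x, k) => match A.region (x, k) with
      | Sum.inl 0 => Sum.inl 0
      | Sum.inl 1 => Sum.inl 1
      | Sum.inl 2 => Sum.inl 2
      | Sum.inl 3 => Sum.inr none
      | Sum.inr i => Sum.inr (some (Sum.inl i))
    | (Sum.inr x, k) => match B.region (x, k) with
      | Sum.inl 0 => Sum.inl 0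
      | Sum.inl 1 => Sum.inr none
      | Sum.inl 2 => Sum.inl 2
      | Sum.inl 3 => Sum.inl 3
      | Sum.inr i => Sum.inr (some (Sum.inr i))
  | prod A B => fun d => match d with
    | (Sum.inl x, k) => match A.region (x, k) with
      | Sum.inl 0 => Sum.inl 0
      | Sum.inl 1 => Sum.inl 1
      | Sum.inl 2 => Sum.inr none
      | Sum.inl 3 => Sum.inl 3
      | Sum.inr i => Sum.inr (some (Sum.inl i))
    | (Sum.inr x, k) => match B.region (x, k) with
      | Sum.inl 0 => Sum.inr none
      | Sum.inl 1 => Sum.inl 1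
      | Sum.inl 2 => Sum.inl 2
      | Sum.inl 3 => Sum.inl 3
      | Sum.inr i => Sum.inr (some (Sum.inr i))

/-- A corner in a given inner region. -/
def innerCorner : (T : Tangle) → T.Inner → T.Dart
  | crossing _ => Empty.elim
  | sum A B => fun i => match i with
    | none => (Sum.inl (A.endCrossing 3), 3)
    | some (Sum.inl i) => (Sum.inl (A.innerCorner i).1, (A.innerCorner i).2)
    | some (Sum.inr i) => (Sum.inr (B.innerCorner i).1, (B.innerCorner i).2)
  | prod A B => fun i => match i with
    | none => (Sum.inl (A.endCrossing 2), 2)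
    | some (Sum.inl i) => (Sum.inl (A.innerCorner i).1, (A.innerCorner i).2)
    | some (Sum.inr i) => (Sum.inr (B.innerCorner i).1, (B.innerCorner i).2)

theorem region_endCrossing (T : Tangle) (k : Fin 4) :
    T.region (T.endCrossing k, k) = Sum.inl k := by
  induction T generalizing k with
  | crossing s => rfl
  | sum A B hA hB =>
    rcases fin_four k with rfl | rfl | rfl | rfl <;> simp [endCrossing, region, hA, hB]
  | prod A B hA hB =>
    rcases fin_four k with rfl | rfl | rfl | rfl <;> simp [endCrossing, region, hA, hB]

/-- The boundary region `k` touches the strands at both marked points `k` and `k + 1`, possibly at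
different crossings. The view from the second point is needed because following an arc lowers the
corner index by one. -/
theorem region_endCrossing_add_one (T : Tangle) (k : Fin 4) :
    T.region (T.endCrossing (k + 1), k) = Sum.inl k := by
  induction T generalizing k with
  | crossing s => rfl
  | sum A B hA hB =>
    rcases fin_four k with rfl | rfl | rfl | rfl
    · have h' : A.region (A.endCrossing 1, 0) = Sum.inl 0 := hA 0
      simp [endCrossing, region, h']
    · have h' : A.region (A.endCrossing 2, 1) = Sum.inl 1 := hA 1
      simp [endCrossing, region, h']
    · have h' : B.region (B.endCrossing 3, 2) = Sum.inl 2 := hB 2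
      simp [endCrossing, region, h']
    · have h' : B.region (B.endCrossing 0, 3) = Sum.inl 3 := hB 3
      simp [endCrossing, region, h']
  | prod A B hA hB =>
    rcases fin_four k with rfl | rfl | rfl | rfl
    · have h' : A.region (A.endCrossing 1, 0) = Sum.inl 0 := hA 0
      simp [endCrossing, region, h']
    · have h' : B.region (B.endCrossing 2, 1) = Sum.inl 1 := hB 1
      simp [endCrossing, region, h']
    · have h' : B.region (B.endCrossing 3, 2) = Sum.inl 2 := hB 2
      simp [endCrossing, region, h']
    · have h' : A.region (A.endCrossing 0, 3) = Sum.inl 3 := hA 3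
      simp [endCrossing, region, h']

theorem region_innerCorner (T : Tangle) (i : T.Inner) :
    T.region (T.innerCorner i) = Sum.inr i := by
  induction T with
  | crossing s => exact i.elim
  | sum A B hA hB =>
    rcases i with _ | i | i <;> simp [innerCorner, region, hA, hB, region_endCrossing]
  | prod A B hA hB =>
    rcases i with _ | i | i <;> simp [innerCorner, region, hA, hB, region_endCrossing]

/-- The checkerboard colouring of the regions that meet the boundary. -/
theorem even_iff_of_region_eq_inl (T : Tangle) (d : T.Dart) (j : Fin 4)
    (h : T.region d = Sum.inl j) : Even j.val ↔ Even d.2.val := by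
  induction T generalizing j with
  | crossing s =>
    simp only [region, Sum.inl.injEq] at h
    rw [h]
  | sum A B hA hB =>
    obtain ⟨x | x, k⟩ := d
    · rcases hp : A.region (x, k) with i | i
      -- A region that still meets the boundary after gluing keeps its number, hence its colour.
      · rw [← hA _ _ hp]
        rcases fin_four i with rfl | rfl | rfl | rfl <;> simp [region, hp] at h <;> subst h <;> rfl
      · simp [region, hp] at h
    · rcases hp : B.region (x, k) with i | i
      · rw [← hB _ _ hp]
        rcases fin_four i with rfl | rfl | rfl | rfl <;> simp [region, hp] at h <;> subst h <;> rfl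
      · simp [region, hp] at h
  | prod A B hA hB =>
    obtain ⟨x | x, k⟩ := d
    · rcases hp : A.region (x, k) with i | i
      · rw [← hA _ _ hp]
        rcases fin_four i with rfl | rfl | rfl | rfl <;> simp [region, hp] at h <;> subst h <;> rfl
      · simp [region, hp] at h
    · rcases hp : B.region (x, k) with i | i
      · rw [← hB _ _ hp]
        rcases fin_four i with rfl | rfl | rfl | rfl <;> simp [region, hp] at h <;> subst h <;> rfl
      · simp [region, hp] at h

theorem fin_four_neg_one : (-1 : Fin 4) = 3 := rfl

/-- The region is constant along the sides of the arcs. -/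
theorem region_eq_of_partner (T : Tangle) (d e : T.Dart) (h : T.partner d = Sum.inl e) :
    T.region d = T.region (e.1, e.2 - 1) := by
  induction T with
  | crossing s => simp [partner] at h
  | sum A B hA hB =>
    have a0 : A.region (A.endCrossing 1, 0) = Sum.inl 0 := A.region_endCrossing_add_one 0
    have a1 : A.region (A.endCrossing 2, 1) = Sum.inl 1 := A.region_endCrossing_add_one 1
    have a2 : A.region (A.endCrossing 3, 2) = Sum.inl 2 := A.region_endCrossing_add_one 2
    have a3 : A.region (A.endCrossing 0, 3) = Sum.inl 3 := A.region_endCrossing_add_one 3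
    have b0 : B.region (B.endCrossing 1, 0) = Sum.inl 0 := B.region_endCrossing_add_one 0
    have b1 : B.region (B.endCrossing 2, 1) = Sum.inl 1 := B.region_endCrossing_add_one 1
    have b2 : B.region (B.endCrossing 3, 2) = Sum.inl 2 := B.region_endCrossing_add_one 2
    have b3 : B.region (B.endCrossing 0, 3) = Sum.inl 3 := B.region_endCrossing_add_one 3
    obtain ⟨x | x, j⟩ := d
    · rcases hp : A.partner (x, j) with f | i
      · have hs := hA (x, j) f hp
        simp only [partner, hp, Sum.inl.injEq] at h
        subst h
        simp [region, hs]
      · have hx := A.eq_endDart_of_partner (x, j) i hp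
        simp only [endDart, Prod.mk.injEq] at hx
        obtain ⟨rfl, rfl⟩ := hx
        rcases fin_four j with rfl | rfl | rfl | rfl <;> simp [partner, hp] at h <;>
          subst h <;> simp [region, b0, b1, region_endCrossing]
    · rcases hp : B.partner (x, j) with f | i
      · have hs := hB (x, j) f hp
        simp only [partner, hp, Sum.inl.injEq] at h
        subst h
        simp [region, hs]
      · have hx := B.eq_endDart_of_partner (x, j) i hp
        simp only [endDart, Prod.mk.injEq] at hx
        obtain ⟨rfl, rfl⟩ := hx
        rcases fin_four j with rfl | rfl | rfl | rfl <;> simp [partner, hp] at h <;>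
          subst h <;> simp [region, a2, a3, region_endCrossing, fin_four_neg_one]
  | prod A B hA hB =>
    have a0 : A.region (A.endCrossing 1, 0) = Sum.inl 0 := A.region_endCrossing_add_one 0
    have a1 : A.region (A.endCrossing 2, 1) = Sum.inl 1 := A.region_endCrossing_add_one 1
    have a2 : A.region (A.endCrossing 3, 2) = Sum.inl 2 := A.region_endCrossing_add_one 2
    have a3 : A.region (A.endCrossing 0, 3) = Sum.inl 3 := A.region_endCrossing_add_one 3
    have b0 : B.region (B.endCrossing 1, 0) = Sum.inl 0 := B.region_endCrossing_add_one 0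
    have b1 : B.region (B.endCrossing 2, 1) = Sum.inl 1 := B.region_endCrossing_add_one 1
    have b2 : B.region (B.endCrossing 3, 2) = Sum.inl 2 := B.region_endCrossing_add_one 2
    have b3 : B.region (B.endCrossing 0, 3) = Sum.inl 3 := B.region_endCrossing_add_one 3
    obtain ⟨x | x, j⟩ := d
    · rcases hp : A.partner (x, j) with f | i
      · have hs := hA (x, j) f hp
        simp only [partner, hp, Sum.inl.injEq] at h
        subst h
        simp [region, hs]
      · have hx := A.eq_endDart_of_partner (x, j) i hp
        simp only [endDart, Prod.mk.injEq] at hx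
        obtain ⟨rfl, rfl⟩ := hx
        rcases fin_four j with rfl | rfl | rfl | rfl <;> simp [partner, hp] at h <;>
          subst h <;> simp [region, b0, b3, region_endCrossing, fin_four_neg_one]
    · rcases hp : B.partner (x, j) with f | i
      · have hs := hB (x, j) f hp
        simp only [partner, hp, Sum.inl.injEq] at h
        subst h
        simp [region, hs]
      · have hx := B.eq_endDart_of_partner (x, j) i hp
        simp only [endDart, Prod.mk.injEq] at hx
        obtain ⟨rfl, rfl⟩ := hx
        rcases fin_four j with rfl | rfl | rfl | rfl <;> simp [partner, hp] at h <;>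
          subst h <;> simp [region, a1, a2, region_endCrossing]

/-! ### The universal property of the regions, and connectedness of tangles -/

/-- A function on the corners that is constant along the sides of the arcs. -/
def IsRegional (T : Tangle) {Y : Type*} (q : T.Dart → Y) : Prop :=
  ∀ d e, T.partner d = Sum.inl e → q d = q (e.1, e.2 - 1)

theorem isRegional_inl_of_sum {A B : Tangle} {Y : Type*} {q : (sum A B).Dart → Y}
    (h : IsRegional _ q) : A.IsRegional fun d => q (Sum.inl d.1, d.2) :=
  fun d e hd => h (Sum.inl d.1, d.2) (Sum.inl e.1, e.2) (by simp [partner, hd])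

theorem isRegional_inr_of_sum {A B : Tangle} {Y : Type*} {q : (sum A B).Dart → Y}
    (h : IsRegional _ q) : B.IsRegional fun d => q (Sum.inr d.1, d.2) :=
  fun d e hd => h (Sum.inr d.1, d.2) (Sum.inr e.1, e.2) (by simp [partner, hd])

theorem isRegional_inl_of_prod {A B : Tangle} {Y : Type*} {q : (prod A B).Dart → Y}
    (h : IsRegional _ q) : A.IsRegional fun d => q (Sum.inl d.1, d.2) :=
  fun d e hd => h (Sum.inl d.1, d.2) (Sum.inl e.1, e.2) (by simp [partner, hd])

theorem isRegional_inr_of_prod {A B : Tangle} {Y : Type*} {q : (prod A B).Dart → Y}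
    (h : IsRegional _ q) : B.IsRegional fun d => q (Sum.inr d.1, d.2) :=
  fun d e hd => h (Sum.inr d.1, d.2) (Sum.inr e.1, e.2) (by simp [partner, hd])

theorem partner_endCrossing (T : Tangle) (k : Fin 4) :
    T.partner (T.endCrossing k, k) = Sum.inr k :=
  T.partner_endDart k

/-- The two corners at the ends of a boundary arc of the disc lie in the same region. -/
theorem IsRegional.endCrossing {T : Tangle} {Y : Type*} {q : T.Dart → Y} (h : T.IsRegional q)
    (k : Fin 4) : q (T.endCrossing (k + 1), k) = q (T.endCrossing k, k) := by
  induction T generalizing k with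
  | crossing s => rfl
  | sum A B hA hB =>
    have a := hA (isRegional_inl_of_sum h)
    have b := hB (isRegional_inr_of_sum h)
    -- The north of the sum runs along the north of `A`, past the joining arc and along the north of
    -- `B`; the south is similar. West and east belong to one part only.
    have h0 := h (Sum.inl (A.endCrossing 0), 0) (Sum.inr (B.endCrossing 1), 1)
      (by simp [partner, partner_endCrossing])
    have h2 := h (Sum.inr (B.endCrossing 2), 2) (Sum.inl (A.endCrossing 3), 3)
      (by simp [partner, partner_endCrossing])
    rcases fin_four k with rfl | rfl | rfl | rfl
    · exact (a 0).trans (h0.trans (b 0))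
    · exact a 1
    · exact (b 2).trans (h2.trans (a 2))
    · exact b 3
  | prod A B hA hB =>
    have a := hA (isRegional_inl_of_prod h)
    have b := hB (isRegional_inr_of_prod h)
    have h1 := h (Sum.inr (B.endCrossing 1), 1) (Sum.inl (A.endCrossing 2), 2)
      (by simp [partner, partner_endCrossing])
    have h3 := h (Sum.inl (A.endCrossing 3), 3) (Sum.inr (B.endCrossing 0), 0)
      (by simp [partner, partner_endCrossing])
    rcases fin_four k with rfl | rfl | rfl | rfl
    · exact a 0
    · exact (b 1).trans (h1.trans (a 1))
    · exact b 2
    · exact (a 3).trans (h3.trans (b 3))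

/-- A function that is constant along the sides of the arcs factors through the regions. -/
theorem IsRegional.eq_region {T : Tangle} {Y : Type*} {q : T.Dart → Y} (h : T.IsRegional q)
    (d : T.Dart) :
    q d = Sum.elim (fun k => q (T.endDart k)) (fun i => q (T.innerCorner i)) (T.region d) := by
  induction T with
  | crossing s => rfl
  | sum A B hA hB =>
    have a := hA (isRegional_inl_of_sum h)
    have b := hB (isRegional_inr_of_sum h)
    -- Each region has one chosen representative: for the north it lies in `B`, for the south in
    -- `A`, and for the new inner region it is the east corner of `A`. The values at the other
    -- part's corners are carried there.
    have h0 : q (Sum.inl (A.endCrossing 0), 0) = q (Sum.inr (B.endCrossing 0), 0) :=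
      (h (Sum.inl (A.endCrossing 0), 0) (Sum.inr (B.endCrossing 1), 1)
        (by simp [partner, partner_endCrossing])).trans ((isRegional_inr_of_sum h).endCrossing 0)
    have h1 : q (Sum.inr (B.endCrossing 1), 1) = q (Sum.inl (A.endCrossing 3), 3) :=
      (h (Sum.inr (B.endCrossing 1), 1) (Sum.inl (A.endCrossing 0), 0)
        (by simp [partner, partner_endCrossing])).trans ((isRegional_inl_of_sum h).endCrossing 3)
    have h2 : q (Sum.inr (B.endCrossing 2), 2) = q (Sum.inl (A.endCrossing 2), 2) :=
      (h (Sum.inr (B.endCrossing 2), 2) (Sum.inl (A.endCrossing 3), 3)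
        (by simp [partner, partner_endCrossing])).trans ((isRegional_inl_of_sum h).endCrossing 2)
    obtain ⟨x | x, k⟩ := d
    · have e := a (x, k)
      rcases hp : A.region (x, k) with i | i
      · rw [hp] at e
        rcases fin_four i with rfl | rfl | rfl | rfl
        · simp only [region, hp]
          exact e.trans h0
        · simp only [region, hp]
          exact e
        · simp only [region, hp]
          exact e
        · simp only [region, hp]
          exact e
      · rw [hp] at e
        simp only [region, hp]
        exact e
    · have e := b (x, k)
      rcases hp : B.region (x, k) with i | i
      · rw [hp] at e
        rcases fin_four i with rfl | rfl | rfl | rfl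
        · simp only [region, hp]
          exact e
        · simp only [region, hp]
          exact e.trans h1
        · simp only [region, hp]
          exact e.trans h2
        · simp only [region, hp]
          exact e
      · rw [hp] at e
        simp only [region, hp]
        exact e
  | prod A B hA hB =>
    have a := hA (isRegional_inl_of_prod h)
    have b := hB (isRegional_inr_of_prod h)
    have h3 : q (Sum.inl (A.endCrossing 3), 3) = q (Sum.inr (B.endCrossing 3), 3) :=
      (h (Sum.inl (A.endCrossing 3), 3) (Sum.inr (B.endCrossing 0), 0)
        (by simp [partner, partner_endCrossing])).trans ((isRegional_inr_of_prod h).endCrossing 3)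
    have h0 : q (Sum.inr (B.endCrossing 0), 0) = q (Sum.inl (A.endCrossing 2), 2) :=
      (h (Sum.inr (B.endCrossing 0), 0) (Sum.inl (A.endCrossing 3), 3)
        (by simp [partner, partner_endCrossing])).trans ((isRegional_inl_of_prod h).endCrossing 2)
    have h1 : q (Sum.inr (B.endCrossing 1), 1) = q (Sum.inl (A.endCrossing 1), 1) :=
      (h (Sum.inr (B.endCrossing 1), 1) (Sum.inl (A.endCrossing 2), 2)
        (by simp [partner, partner_endCrossing])).trans ((isRegional_inl_of_prod h).endCrossing 1)
    obtain ⟨x | x, k⟩ := d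
    · have e := a (x, k)
      rcases hp : A.region (x, k) with i | i
      · rw [hp] at e
        rcases fin_four i with rfl | rfl | rfl | rfl
        · simp only [region, hp]
          exact e
        · simp only [region, hp]
          exact e
        · simp only [region, hp]
          exact e
        · simp only [region, hp]
          exact e.trans h3
      · rw [hp] at e
        simp only [region, hp]
        exact e
    · have e := b (x, k)
      rcases hp : B.region (x, k) with i | i
      · rw [hp] at e
        rcases fin_four i with rfl | rfl | rfl | rfl
        · simp only [region, hp]
          exact e.trans h0
        · simp only [region, hp]
          exact e.trans h1
        · simp only [region, hp]
          exact e
        · simp only [region, hp]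
          exact e
      · rw [hp] at e
        simp only [region, hp]
        exact e

/-- Tangle diagrams are connected. -/
theorem eq_of_step {T : Tangle} {Y : Type*} {q : T.Dart → Y}
    (h : ∀ x k l, q (x, k) = q (x, l)) (h' : ∀ d e, T.partner d = Sum.inl e → q d = q e)
    (d e : T.Dart) : q d = q e := by
  induction T with
  | crossing s => exact h () d.2 e.2
  | sum A B hA hB =>
    have a := hA (q := fun d => q (Sum.inl d.1, d.2)) (fun x => h (Sum.inl x))
      fun d e hd => h' _ _ (by simp [partner, hd])
    have b := hB (q := fun d => q (Sum.inr d.1, d.2)) (fun x => h (Sum.inr x))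
      fun d e hd => h' _ _ (by simp [partner, hd])
    have ab := h' (Sum.inl (A.endCrossing 0), 0) (Sum.inr (B.endCrossing 1), 1)
      (by simp [partner, partner_endCrossing])
    obtain ⟨x | x, k⟩ := d <;> obtain ⟨y | y, l⟩ := e
    · exact a (x, k) (y, l)
    · exact (a (x, k) (A.endCrossing 0, 0)).trans (ab.trans (b (B.endCrossing 1, 1) (y, l)))
    · exact ((a (y, l) (A.endCrossing 0, 0)).trans (ab.trans (b (B.endCrossing 1, 1) (x, k)))).symm
    · exact b (x, k) (y, l)
  | prod A B hA hB =>
    have a := hA (q := fun d => q (Sum.inl d.1, d.2)) (fun x => h (Sum.inl x))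
      fun d e hd => h' _ _ (by simp [partner, hd])
    have b := hB (q := fun d => q (Sum.inr d.1, d.2)) (fun x => h (Sum.inr x))
      fun d e hd => h' _ _ (by simp [partner, hd])
    have ab := h' (Sum.inl (A.endCrossing 3), 3) (Sum.inr (B.endCrossing 0), 0)
      (by simp [partner, partner_endCrossing])
    obtain ⟨x | x, k⟩ := d <;> obtain ⟨y | y, l⟩ := e
    · exact a (x, k) (y, l)
    · exact (a (x, k) (A.endCrossing 3, 3)).trans (ab.trans (b (B.endCrossing 0, 0) (y, l)))
    · exact ((a (y, l) (A.endCrossing 3, 3)).trans (ab.trans (b (B.endCrossing 0, 0) (x, k)))).symm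
    · exact b (x, k) (y, l)

end Tangle
end Twisting

namespace Twisting
namespace OrientedDiagram

/-! ### Darts after the replacement -/

section Replace

variable (D : OrientedDiagram) (c : D.Crossing) (r : Fin 4) {T : Tangle} (o : T.Orientation)
  (h : o.Fits D c r)

theorem liftDart_self (T : Tangle) (k : Fin 4) :
    D.liftDart c r T (c, k) = (Sum.inr (T.endCrossing (k + r)), k + r) := by
  simp [liftDart, Tangle.endDart]

theorem liftDart_of_ne (T : Tangle) {x : D.Crossing} (hx : x ≠ c) (k : Fin 4) :
    D.liftDart c r T (x, k) = (Sum.inl ⟨x, hx⟩, k) := by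
  simp [liftDart, hx]

theorem replaceJoin_of_partner {T : Tangle} {d e : T.Dart} (hd : T.partner d = Sum.inl e) :
    D.replaceJoin c r T (Sum.inr d.1, d.2) = (Sum.inr e.1, e.2) := by
  simp [replaceJoin, hd]

/-- A dart after the replacement is the lift of a dart or lies on an inner arc of the tangle. -/
theorem exists_liftDart_or_partner (T : Tangle)
    (d : ({x : D.Crossing // x ≠ c} ⊕ T.Crossing) × Fin 4) :
    (∃ d', d = D.liftDart c r T d') ∨
      ∃ e f : T.Dart, d = (Sum.inr e.1, e.2) ∧ T.partner e = Sum.inl f := by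
  obtain ⟨x | y, k⟩ := d
  · exact Or.inl ⟨(x.1, k), (D.liftDart_of_ne c r T x.2 k).symm⟩
  · rcases hp : T.partner (y, k) with f | j
    · exact Or.inr ⟨(y, k), f, rfl, hp⟩
    · left
      have hy := T.eq_endDart_of_partner _ _ hp
      simp only [Tangle.endDart, Prod.mk.injEq] at hy
      obtain ⟨rfl, rfl⟩ := hy
      exact ⟨(c, k - r), by rw [liftDart_self, sub_add_cancel]⟩

/-! ### Regions after the replacement -/

/-- The region of `D`, or inner region of the tangle, that corresponds to the region of a side
after the replacement. -/
def replaceRegion (T : Tangle) :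
    (({x : D.Crossing // x ≠ c} ⊕ T.Crossing) × Fin 4) ⊕ (D.Loop × Bool) → D.Region ⊕ T.Inner
  | Sum.inl (Sum.inl x, k) => Sum.inl (D.regionOf (x.1, k))
  | Sum.inl (Sum.inr y, k) => Sum.map (fun j => D.regionOf (c, j - r)) id (T.region (y, k))
  | Sum.inr l => Sum.inl (Quot.mk _ (Sum.inr l))

theorem replaceRegion_lift (T : Tangle) (s : D.Side) :
    D.replaceRegion c r T (Sum.map (D.liftDart c r T) id s) = Sum.inl (Quot.mk _ s) := by
  rcases s with ⟨x, k⟩ | l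
  · by_cases hx : x = c
    · subst hx
      simp only [Sum.map_inl, liftDart_self, replaceRegion, Tangle.region_endCrossing,
        add_sub_cancel_right]
      rfl
    · simp only [Sum.map_inl, liftDart_of_ne _ _ _ _ hx, replaceRegion]
      rfl
  · rfl

/-- Lifting does not commute with passing to the preceding corner: consecutive ends of the disc may
belong to different crossings of the tangle. The two resulting corners still lie in the same
boundary region. -/
theorem replaceRegion_lift_sub_one (T : Tangle) (d : D.Dart) :
    D.replaceRegion c r T (Sum.inl ((D.liftDart c r T d).1, (D.liftDart c r T d).2 - 1)) =
      Sum.inl (D.regionOf (d.1, d.2 - 1)) := by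
  obtain ⟨x, k⟩ := d
  by_cases hx : x = c
  · subst hx
    have hT := T.region_endCrossing_add_one (k + r - 1)
    rw [sub_add_cancel] at hT
    simp only [liftDart_self, replaceRegion, hT, Sum.map_inl]
    rw [add_sub_right_comm, add_sub_cancel_right]
  · simp [liftDart_of_ne _ _ _ _ hx, replaceRegion]

/-- Every arc of the new diagram is the lift of an arc of `D` or an inner arc of the tangle. The
first gives a step between regions of `D`, the second stays in one region of the tangle. -/
theorem replaceRegion_eq_of_regionStep {s t : (D.replace c r o h).Side}
    (hst : (D.replace c r o h).RegionStep s t) :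
    D.replaceRegion c r T s = D.replaceRegion c r T t := by
  rcases hst with d | ⟨_, _, s, t, hst, rfl, rfl⟩
  · change D.replaceRegion c r T (Sum.inl d) = D.replaceRegion c r T
      (Sum.inl ((D.replaceJoin c r T d).1, (D.replaceJoin c r T d).2 - 1))
    rcases D.exists_liftDart_or_partner c r T d with ⟨d, rfl⟩ | ⟨e, f, rfl, hf⟩
    · rw [replaceJoin_liftDart, replaceRegion_lift_sub_one]
      refine (D.replaceRegion_lift c r T (Sum.inl d)).trans ?_
      exact congrArg Sum.inl (Quot.sound (.arc d))
    · rw [D.replaceJoin_of_partner c r hf]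
      simp only [replaceRegion]
      exact congrArg _ (T.region_eq_of_partner e f hf)
  · refine (D.replaceRegion_lift c r T s).trans (Eq.trans ?_ (D.replaceRegion_lift c r T t).symm)
    exact congrArg Sum.inl (Quot.sound (.glue s t hst))

/-- Inner arcs of the tangle remain arcs of the new diagram, so the universal property of the tangle
regions applies to its quotient map. -/
theorem isRegional_regionOf_replace :
    T.IsRegional fun d => (D.replace c r o h).regionOf (Sum.inr d.1, d.2) := by
  intro d e hd
  refine Quot.sound ?_
  have hs := RegionStep.arc (D := D.replace c r o h) (Sum.inr d.1, d.2)
  rwa [show (D.replace c r o h).join (Sum.inr d.1, d.2) = (Sum.inr e.1, e.2) from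
    D.replaceJoin_of_partner c r hd] at hs

theorem regionOf_lift_sub_one (d : D.Dart) :
    (D.replace c r o h).regionOf ((D.liftDart c r T d).1, (D.liftDart c r T d).2 - 1) =
      (D.replace c r o h).regionOf (D.liftDart c r T (d.1, d.2 - 1)) := by
  obtain ⟨x, k⟩ := d
  by_cases hx : x = c
  · subst hx
    have hT := (D.isRegional_regionOf_replace x r o h).endCrossing (k + r - 1)
    rw [sub_add_cancel] at hT
    simp only [liftDart_self]
    rw [sub_add_eq_add_sub]
    exact hT
  · simp only [liftDart_of_ne _ _ _ _ hx]
    rfl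

/-- The region after the replacement that corresponds to a region of `D`. -/
noncomputable def liftRegion : D.Region → (D.replace c r o h).Region :=
  Quot.lift (fun s => Quot.mk _ (Sum.map (D.liftDart c r T) id s)) <| by
    rintro _ _ (d | ⟨_, _, hst⟩)
    -- The lifted arc ends at the corner preceding the lifted dart, which is then exchanged for the
    -- lift of the preceding corner.
    · refine Eq.trans ?_ (D.regionOf_lift_sub_one c r o h (D.join d))
      have hs := RegionStep.arc (D := D.replace c r o h) (D.liftDart c r T d)
      rw [show (D.replace c r o h).join (D.liftDart c r T d) = D.liftDart c r T (D.join d) from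
        D.replaceJoin_liftDart c r T d] at hs
      exact Quot.sound hs
    · exact Quot.sound (.glue _ _ ⟨_, _, hst, rfl, rfl⟩)

/-- The regions after the replacement are those of `D` and the inner regions of the tangle. -/
noncomputable def replaceRegionEquiv :
    (D.replace c r o h).Region ≃ D.Region ⊕ T.Inner where
  toFun := Quot.lift (D.replaceRegion c r T) fun _ _ => D.replaceRegion_eq_of_regionStep c r o h
  invFun := Sum.elim (D.liftRegion c r o h) fun i =>
    (D.replace c r o h).regionOf (Sum.inr (T.innerCorner i).1, (T.innerCorner i).2)
  left_inv := by
    rintro ⟨(⟨x | y, k⟩ | l)⟩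
    · change Quot.mk _ (Sum.inl (D.liftDart c r T (x.1, k))) = _
      rw [liftDart_of_ne _ _ _ _ x.2]
      rfl
    -- A tangle corner is equivalent, in the new diagram, to the representative of its tangle
    -- region; hence no region is split.
    · refine Eq.trans ?_ ((D.isRegional_regionOf_replace c r o h).eq_region (y, k)).symm
      change Sum.elim _ _ (Sum.map _ _ (T.region (y, k))) = _
      rcases T.region (y, k) with j | i
      · change (D.replace c r o h).regionOf (D.liftDart c r T (c, j - r)) = _
        rw [liftDart_self, sub_add_cancel]
        rfl
      · rfl
    · rfl
  right_inv := by
    rintro (R | i)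
    · obtain ⟨s, rfl⟩ := Quot.exists_rep R
      exact D.replaceRegion_lift c r T s
    · change Sum.map _ _ (T.region (T.innerCorner i)) = _
      rw [T.region_innerCorner]
      rfl

/-! ### Connected pieces after the replacement -/

/-- The piece of `D` that corresponds to the piece of a side after the replacement. -/
def replacePiece (T : Tangle) :
    (({x : D.Crossing // x ≠ c} ⊕ T.Crossing) × Fin 4) ⊕ (D.Loop × Bool) → D.Piece
  | Sum.inl (Sum.inl x, k) => Quot.mk _ (Sum.inl (x.1, k))
  | Sum.inl (Sum.inr _, _) => Quot.mk _ (Sum.inl (c, 0))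
  | Sum.inr l => Quot.mk _ (Sum.inr l)

theorem replacePiece_lift (T : Tangle) (s : D.Side) :
    D.replacePiece c T (Sum.map (D.liftDart c r T) id s) = Quot.mk _ s := by
  rcases s with ⟨x, k⟩ | l
  · by_cases hx : x = c
    · subst hx
      simp only [Sum.map_inl, liftDart_self, replacePiece]
      exact Quot.sound (.crossing x 0 k)
    · simp only [Sum.map_inl, liftDart_of_ne _ _ _ _ hx, replacePiece]
      rfl
  · rfl

theorem replacePiece_eq_of_pieceStep {s t : (D.replace c r o h).Side}
    (hst : (D.replace c r o h).PieceStep s t) : D.replacePiece c T s = D.replacePiece c T t := by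
  rcases hst with ⟨x | y, k, l⟩ | d | ⟨l, a, b⟩
  · exact Quot.sound (.crossing x.1 k l)
  · rfl
  · change D.replacePiece c T (Sum.inl d) = D.replacePiece c T (Sum.inl (D.replaceJoin c r T d))
    rcases D.exists_liftDart_or_partner c r T d with ⟨d, rfl⟩ | ⟨e, f, rfl, hf⟩
    · rw [replaceJoin_liftDart]
      refine (D.replacePiece_lift c r T (Sum.inl d)).trans
        (Eq.trans ?_ (D.replacePiece_lift c r T (Sum.inl (D.join d))).symm)
      exact Quot.sound (.arc d)
    · rw [D.replaceJoin_of_partner c r hf]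
      rfl
  · exact Quot.sound (PieceStep.loop (D := D) l a b)

theorem piece_eq_of_tangle (d e : T.Dart) :
    (Quot.mk _ (Sum.inl (Sum.inr d.1, d.2)) : (D.replace c r o h).Piece) =
      Quot.mk _ (Sum.inl (Sum.inr e.1, e.2)) := by
  refine Tangle.eq_of_step
    (q := fun d => (Quot.mk _ (Sum.inl (Sum.inr d.1, d.2)) : (D.replace c r o h).Piece))
    (fun x k l => Quot.sound (.crossing _ k l)) (fun d e hd => ?_) d e
  have hs := PieceStep.arc (D := D.replace c r o h) (Sum.inr d.1, d.2)
  rw [show (D.replace c r o h).join (Sum.inr d.1, d.2) = (Sum.inr e.1, e.2) from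
    D.replaceJoin_of_partner c r hd] at hs
  exact Quot.sound hs

/-- The piece after the replacement that corresponds to a piece of `D`. -/
noncomputable def liftPiece : D.Piece → (D.replace c r o h).Piece :=
  Quot.lift (fun s => Quot.mk _ (Sum.map (D.liftDart c r T) id s)) <| by
    rintro _ _ (⟨x, k, l⟩ | d | ⟨l, a, b⟩)
    · by_cases hx : x = c
      · subst hx
        change Quot.mk _ (Sum.inl (D.liftDart x r T (x, k))) =
          Quot.mk _ (Sum.inl (D.liftDart x r T (x, l)))
        rw [liftDart_self, liftDart_self]
        exact D.piece_eq_of_tangle x r o h (T.endDart (k + r)) (T.endDart (l + r))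
      · change Quot.mk _ (Sum.inl (D.liftDart c r T (x, k))) =
          Quot.mk _ (Sum.inl (D.liftDart c r T (x, l)))
        rw [liftDart_of_ne _ _ _ _ hx, liftDart_of_ne _ _ _ _ hx]
        exact Quot.sound (.crossing _ k l)
    · have hs := PieceStep.arc (D := D.replace c r o h) (D.liftDart c r T d)
      rw [show (D.replace c r o h).join (D.liftDart c r T d) = D.liftDart c r T (D.join d) from
        D.replaceJoin_liftDart c r T d] at hs
      exact Quot.sound hs
    · exact Quot.sound (PieceStep.loop (D := D.replace c r o h) l a b)

/-- The replacement does not change the connected pieces. -/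
noncomputable def replacePieceEquiv : (D.replace c r o h).Piece ≃ D.Piece where
  toFun := Quot.lift (D.replacePiece c T) fun _ _ => D.replacePiece_eq_of_pieceStep c r o h
  invFun := D.liftPiece c r o h
  left_inv := by
    rintro ⟨(⟨x | y, k⟩ | l)⟩
    · change Quot.mk _ (Sum.inl (D.liftDart c r T (x.1, k))) = _
      rw [liftDart_of_ne _ _ _ _ x.2]
      rfl
    · change Quot.mk _ (Sum.inl (D.liftDart c r T (c, 0))) = _
      rw [liftDart_self]
      exact D.piece_eq_of_tangle c r o h (T.endDart (0 + r)) (y, k)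
    · rfl
  right_inv := by
    intro P
    obtain ⟨s, rfl⟩ := Quot.exists_rep P
    exact D.replacePiece_lift c r T s

/-! ### Euler's formula and sphericity -/

theorem card_crossing_replace :
    Nat.card (D.replace c r o h).Crossing = Nat.card D.Crossing + Nat.card T.Inner := by
  classical
  have := D.finite_crossing
  have := Fintype.ofFinite D.Crossing
  change Nat.card ({x : D.Crossing // x ≠ c} ⊕ T.Crossing) = _
  rw [Nat.card_sum, T.card_crossing]
  have hc : Nat.card {x : D.Crossing // x ≠ c} + 1 = Nat.card D.Crossing := by
    rw [← Finite.card_option]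
    exact Nat.card_congr (Equiv.optionSubtypeNe c)
  omega

/-- The replacement of a crossing by an oriented tangle in a diagram on the sphere is a
diagram on the sphere. -/
theorem IsSpherical.replace {D : OrientedDiagram} (hD : D.IsSpherical) (c : D.Crossing) (r : Fin 4)
    {T : Tangle} (o : T.Orientation) (h : o.Fits D c r) : (D.replace c r o h).IsSpherical where
  connected := by
    have region : ∀ s t : D.Side, D.RegionStep s t →
        Relation.EqvGen (D.replace c r o h).RegionStep (Sum.map (D.liftDart c r T) id s)
          (Sum.map (D.liftDart c r T) id t) := fun s t hst =>
      -- Since lifting is well defined on regions, a step of `D` gives equal classes, and hence a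
      -- chain of steps between the lifts.
      Quot.eqvGen_exact (congrArg (D.liftRegion c r o h) (Quot.sound hst))
    have piece : ∀ s t : D.Side, D.PieceStep s t →
        Relation.EqvGen (D.replace c r o h).PieceStep (Sum.map (D.liftDart c r T) id s)
          (Sum.map (D.liftDart c r T) id t) := fun s t hst =>
      Quot.eqvGen_exact (congrArg (D.liftPiece c r o h) (Quot.sound hst))
    have lift : ∀ s t : D.Side,
        Relation.EqvGen (fun a b => (D.replace c r o h).RegionStep a b ∨
          (D.replace c r o h).PieceStep a b) (Sum.map (D.liftDart c r T) id s)
          (Sum.map (D.liftDart c r T) id t) := by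
      intro s t
      induction hD.connected s t with
      | rel s t hst =>
        rcases hst with hst | hst
        · exact (region s t hst).mono fun _ _ => Or.inl
        · exact (piece s t hst).mono fun _ _ => Or.inr
      | refl s => exact .refl _
      | symm s t _ ih => exact .symm _ _ ih
      | trans s t u _ _ ih₁ ih₂ => exact .trans _ _ _ ih₁ ih₂
    have exists_lift : ∀ s' : (D.replace c r o h).Side, ∃ s : D.Side,
        Relation.EqvGen (fun a b => (D.replace c r o h).RegionStep a b ∨
          (D.replace c r o h).PieceStep a b) s' (Sum.map (D.liftDart c r T) id s) := by
      intro s'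
      -- The map on pieces is onto, so each side shares its piece with a lifted side; connectedness
      -- then needs checking only on lifts.
      obtain ⟨⟨s⟩, hs⟩ := (D.replacePieceEquiv c r o h).symm.surjective (Quot.mk _ s')
      exact ⟨s, (Quot.eqvGen_exact hs.symm).mono fun _ _ => Or.inr⟩
    intro s' t'
    obtain ⟨s, hs⟩ := exists_lift s'
    obtain ⟨t, ht⟩ := exists_lift t'
    exact .trans _ _ _ hs (.trans _ _ _ (lift s t) (.symm _ _ ht))
  euler := by
    have := D.finite_crossing
    have := D.finite_loop
    -- Additivity of `Nat.card` on sums requires finiteness, as infinite types have cardinality `0`.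
    have : Finite D.Region := Quot.finite _
    rw [Nat.card_congr (D.replaceRegionEquiv c r o h), Nat.card_sum, hD.euler,
      Nat.card_congr (D.replacePieceEquiv c r o h), card_crossing_replace]
    omega

end Replace
end OrientedDiagram
end Twisting

namespace Twisting

/-! ### Unoriented signs in blocks -/

namespace Tangle

/-- All crossings of the tangle diagram have the given unoriented sign. -/
def HasSlope (ε : ℤˣ) (T : Tangle) : Prop := ∀ x, T.slope x = ε

theorem hasSlope_crossing (ε : ℤˣ) : (crossing ε).HasSlope ε := fun _ => rfl

theorem HasSlope.sum {ε : ℤˣ} {A B : Tangle} (hA : A.HasSlope ε) (hB : B.HasSlope ε) :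
    (sum A B).HasSlope ε := by
  rintro (x | x)
  exacts [hA x, hB x]

theorem HasSlope.prod {ε : ℤˣ} {A B : Tangle} (hA : A.HasSlope ε) (hB : B.HasSlope ε) :
    (prod A B).HasSlope ε := by
  rintro (x | x)
  exacts [hA x, hB x]

theorem HasSlope.addHorizontal {ε : ℤˣ} {T : Tangle} (hT : T.HasSlope ε) {b : Box}
    (hb : unitSign b.a = ε) : (b.addHorizontal T).HasSlope ε := by
  subst hb
  exact Function.Iterate.rec (HasSlope _) (Function.Iterate.rec (HasSlope _) hT
    (fun _ h => h.sum (hasSlope_crossing _)) _) (fun _ h => (hasSlope_crossing _).sum h) _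

theorem HasSlope.addVertical {ε : ℤˣ} {T : Tangle} (hT : T.HasSlope ε) {b : Box}
    (hb : unitSign b.a = ε) : (b.addVertical T).HasSlope ε := by
  subst hb
  exact Function.Iterate.rec (HasSlope _) (Function.Iterate.rec (HasSlope _) hT
    (fun _ h => h.prod (hasSlope_crossing _)) _) (fun _ h => (hasSlope_crossing _).prod h) _

theorem HasSlope.addBoxes {ε : ℤˣ} {l : List Box} (hl : ∀ b ∈ l, unitSign b.a = ε)
    (vertical : Bool) {T : Tangle} (hT : T.HasSlope ε) : (addBoxes vertical l T).HasSlope ε := by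
  induction l generalizing vertical T with
  | nil => cases vertical <;> exact hT
  | cons b l ih =>
    have hb := hl b (by simp)
    have ih' := fun v {S : Tangle} (hS : S.HasSlope ε) =>
      ih (fun b hb => hl b (List.mem_cons_of_mem _ hb)) v hS
    cases vertical
    · exact ih' true (hT.addHorizontal hb)
    · exact ih' false (hT.addVertical hb)

end Tangle

theorem RationalTangle.Extends.hasSlope {ε : ℤˣ} {R : RationalTangle} (h : R.Extends ε) :
    R.toTangle.HasSlope ε := by
  have h₁ : unitSign R.a₁ = ε := h _ (by simp [denominators])
  refine Tangle.HasSlope.addBoxes (fun b hb => h _ ?_) true ?_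
  · exact List.mem_cons_of_mem _ (List.mem_map_of_mem hb)
  · rw [h₁]
    exact Function.Iterate.rec (Tangle.HasSlope ε) (Tangle.hasSlope_crossing ε)
      (fun _ h => h.sum (Tangle.hasSlope_crossing ε)) _

/-- Sums and products do not rotate their parts, so unoriented signs are inherited from the boxes of
twists. -/
theorem Block.Extends.hasSlope {ε : ℤˣ} {B : Block} (h : B.Extends ε) :
    B.toTangle.HasSlope ε := by
  induction B with
  | rational R => exact RationalTangle.Extends.hasSlope h
  | sum A B hA hB => exact (hA h.1).sum (hB h.2)
  | prod A B hA hB => exact (hA h.1).prod (hB h.2)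

/-! ### Parity of corners and the extended labelling -/

theorem neg_one_pow_val_eq_iff (i j r : Fin 4) :
    (-1 : ℤˣ) ^ r.val * (-1) ^ i.val = (-1) ^ j.val ↔ (Even i.val ↔ Even (j + r).val) := by
  revert i j r
  decide

theorem even_val_add_two (i : Fin 4) : Even (i + 2).val ↔ Even i.val := by
  revert i
  decide

/-- Corners of equal parity are equal or opposite. With `j` the out-corner of `c`, the boundary
region `i` is then the target or the source region of the edge of `c`. -/
theorem eq_or_eq_add_two_of_even_iff {i j r : Fin 4} (h : Even i.val ↔ Even (j + r).val) :
    i - r = j ∨ i - r = j + 2 := by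
  revert i j r
  decide

namespace OrientedDiagram

/-- The replacement of a crossing of an alternative diagram by a tangle all of whose crossings
have the unoriented sign and the type of that crossing is alternative. -/
theorem IsAlternative.replace {D : OrientedDiagram} (hD : D.IsAlternative) (c : D.Crossing)
    (r : Fin 4) {T : Tangle} (o : T.Orientation) (h : o.Fits D c r)
    (hs : T.HasSlope (D.signInDisc c r)) (ht : ∀ y, o.type y = D.type c) :
    IsAlternative (D.replace c r o h) := by
  obtain ⟨f, hf, hf'⟩ := SignedDigraph.isAlternative_iff_exists_labelling.1 hD
  -- The parity condition covers both ends of the edge of `y`, since its source corner is opposite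
  -- to its target corner.
  have key : ∀ (y : T.Crossing) (k : Fin 4),
      (Even k.val ↔ Even (outCorner fun k => o.out (y, k)).val) →
      Sum.elim f (fun _ => D.type c) (D.replaceRegion c r T (Sum.inl (Sum.inr y, k))) =
        D.type c := by
    intro y k hk
    -- Cancelling the common unoriented sign turns equality of types into equality of the parities
    -- of the out-corners, that of `c` being shifted by `r`.
    have hy := ht y
    simp only [Tangle.Orientation.type, crossingType, hs y, signInDisc, type, mul_assoc,
      mul_right_inj, neg_one_pow_val_eq_iff] at hy
    simp only [replaceRegion]
    rcases hp : T.region (y, k) with j | i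
    · have hj := ((T.even_iff_of_region_eq_inl _ _ hp).trans hk).trans hy
      rcases eq_or_eq_add_two_of_even_iff hj with e | e
      · simp only [Sum.map_inl, e]
        exact hf' c
      · simp only [Sum.map_inl, e]
        exact hf c
    · rfl
  refine SignedDigraph.isAlternative_iff_exists_labelling.2
    ⟨fun R => Sum.elim f (fun _ => D.type c) (D.replaceRegionEquiv c r o h R), ?_, ?_⟩
  · rintro (x | y)
    · exact hf x.1
    · exact (key y _ (even_val_add_two _)).trans (ht y).symm
  · rintro (x | y)
    · exact hf' x.1
    · exact (key y _ Iff.rfl).trans (ht y).symm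

end OrientedDiagram

end Twisting

theorem mainTheorem3 (D : Twisting.OrientedDiagram) (hD : D.IsSpherical) (hA : D.IsAlternative)
    (c : D.Crossing) (r : Fin 4) (B : Twisting.Block) (o : B.toTangle.Orientation)
    (hfit : o.Fits D c r) (hext : B.ExtendsOriented o D c r) :
    (D.replace c r o hfit).IsAlternative ∧ (D.replace c r o hfit).IsSpherical :=
  ⟨hA.replace c r o hfit hext.sign.hasSlope hext.type, hD.replace c r o hfit⟩
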